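/- For a set $S\subseteq\mathbb{R}^2$ let $A(S)$ be the number of distinct magnitudes $|\angle abc|\in(0,\pi)$, and let $A_0(S)$ be the number of distinct magnitudes $|\angle abc|\in[0,\pi)$, where $a,b,c$ range over the triples of distinct points of $S$ (so $A_0$ also counts the angle $0$, while the angle $\pi$ is never counted). Then: 1. The largest size of a set $S\subseteq\mathbb{R}^2$, not contained in a line, with $A_0(S)\le 3$ exists and equals $5$. 2. A set $S\subseteq\mathbb{R}^2$ that is not contained in a line satisfies $A_0(S)\le 3$ and $\#S=5$ if and only if $S$ consists of the four vertices of a square and its centre, or of the five vertices of a regular pentagon. These two configurations are not similar to each other. 3. Every five-point set $S\subseteq\mathbb{R}^2$, not contained in a line, with $A(S)\le 3$ that is of neither of these two forms contains three collinear points, and it has $A_0(S)>3$. -/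

import Mathlib

/-- The Euclidean plane. -/
abbrev Plane : Type := EuclideanSpace ℝ (Fin 2)

/-- The angles of magnitude in the set `I` that are formed by three distinct points of `S`
(unoriented angle `∠ a b c ∈ [0, π]` with vertex `b`). -/
def anglesIn (I : Set ℝ) (S : Set Plane) : Set ℝ :=
  {θ | θ ∈ I ∧ ∃ a ∈ S, ∃ b ∈ S, ∃ c ∈ S, a ≠ b ∧ b ≠ c ∧ a ≠ c ∧
    EuclideanGeometry.angle a b c = θ}

/-- The usual count `A(S)`: the number of distinct angles in `(0, π)`. -/
noncomputable def numAngles (S : Set Plane) : ℕ∞ :=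
  (anglesIn (Set.Ioo 0 Real.pi) S).encard

/-- The count in which the angle `0` is included: the number of distinct angles in `[0, π)`. -/
noncomputable def numAnglesWithZero (S : Set Plane) : ℕ∞ :=
  (anglesIn (Set.Ico 0 Real.pi) S).encard

/-- The plane sets, not all on one line, that define at most `k` angles with respect to the
angle count `A`. -/
def Admissible (A : Set Plane → ℕ∞) (k : ℕ) (S : Set Plane) : Prop :=
  ¬ Collinear ℝ S ∧ A S ≤ k

/-- `n = P(k)` with respect to the angle count `A`: the largest size (finite or infinite) of an
admissible set exists and equals `n`. -/
def IsMaxSize (A : Set Plane → ℕ∞) (k : ℕ) (n : ℕ∞) : Prop :=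
  IsGreatest {m : ℕ∞ | ∃ S : Set Plane, Admissible A k S ∧ S.encard = m} n

/-- The set `S` is the image of `T` under a similarity of the plane (a rigid motion, reflections
included, combined with a dilation of positive ratio). -/
def IsSimilarTo (S T : Set Plane) : Prop :=
  ∃ f : Plane ≃ᵈ Plane, f '' T = S

/-- The vertices of a square together with its centre. -/
def squareWithCentre : Set Plane :=
  {!₂[1, 1], !₂[-1, 1], !₂[-1, -1], !₂[1, -1], !₂[0, 0]}

/-- The vertices of a regular pentagon. -/
noncomputable def regularPentagon : Set Plane :=
  Set.range fun j : Fin 5 =>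
    !₂[Real.cos (2 * Real.pi * (j : ℝ) / 5), Real.sin (2 * Real.pi * (j : ℝ) / 5)]

/-- Three distinct points of `S` lie on one line. -/
def HasCollinearTriple (S : Set Plane) : Prop :=
  ∃ a ∈ S, ∃ b ∈ S, ∃ c ∈ S, a ≠ b ∧ b ≠ c ∧ a ≠ c ∧ Collinear ℝ {a, b, c}

/-!
The plane is identified with `ℂ`, and only the hypothesis that at most three angles other than `π`
occur (`AnglesMem T S` with `T.encard ≤ 3`) is used. It is invariant under similarities.

*A collinear triple occurs.* Let `b` lie between `a` and `c`, and let `p` be off their line. The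
angle `0` occurs, so at most two positive angles are left. The angles `∠ p b a` and `∠ p b c` add up
to `π`, and each is the sum of two angles of the other triangle. This is possible only if both are
right and the base angles are `π / 4` (`angles_eq_of_add_eq`), so `b` is the midpoint of `a` and
`c`, and `p` is one of two points (`right_isosceles_of_sbtw`). A fourth point on the line would give
a further triple with another midpoint, from which `p` would have to be seen in the same way. Hence
the set lies in a square with its centre (`exists_subset_square_of_sbtw`), whatever its size.

*No collinear triple occurs.* The lowest point `v` of a finite subset sees all others in distinct
directions within a half-plane (`exists_strictMono_arg`). With six points, the first direction makes
four distinct angles with the others, which is too many (`encard_le_five`). With five points, the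
six differences of four directions take only three values, so the directions are equally spaced and
the angles are `α`, `2 α`, `3 α` (`subset_of_sub_mem`). All angles of the configuration are then
small integer multiples of `α`, and so is `π`. Triangle sums, the fact that points on one side of a
line are seen at different angles, and the addition of angles across a line leave one solution, with
`α = π / 5` (`multiples_eq`, `angles_determined`). Each remaining point is now known as the
intersection of two lines, and these intersections are the vertices of a regular pentagon
(`exists_pentagon_subset`).

Conversely, the angles of the square with its centre are read off integer coordinates, and those of
the pentagon come from the inscribed angle theorem (`angle_exp_exp_exp`). The angle `0`
distinguishes the two configurations. A set without collinear triples has no angle `0`, so both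
counts agree on it, and the last assertion follows from the classification.
-/

open EuclideanGeometry
open scoped Real

/-! ### Angles, collinearity and similarities -/

section Similarities

variable {V W P Q : Type*} [NormedAddCommGroup V] [InnerProductSpace ℝ V] [MetricSpace P]
  [NormedAddTorsor V P] [NormedAddCommGroup W] [InnerProductSpace ℝ W] [MetricSpace Q]
  [NormedAddTorsor W Q]

/-- Every angle of magnitude other than `π` at three distinct points of `S` belongs to `T`. -/
def AnglesMem (T : Set ℝ) (S : Set P) : Prop :=
  ∀ a ∈ S, ∀ b ∈ S, ∀ c ∈ S, a ≠ b → b ≠ c → a ≠ c → ∠ a b c ≠ π → ∠ a b c ∈ T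

theorem angle_map_dilationEquiv (f : P ≃ᵈ Q) (a b c : P) : ∠ (f a) (f b) (f c) = ∠ a b c := by
  have h : Similar ![f a, f b, f c] ![a, b, c] := by
    refine ⟨Dilation.ratio f, Dilation.ratio_ne_zero f, fun i j => ?_⟩
    fin_cases i <;> fin_cases j <;> simp [Dilation.edist_eq]
  exact h.angle_eq

theorem collinear_map_dilationEquiv_iff (f : P ≃ᵈ Q) {a b c : P} :
    Collinear ℝ {f a, f b, f c} ↔ Collinear ℝ {a, b, c} := by
  rw [collinear_iff_eq_or_eq_or_angle_eq_zero_or_angle_eq_pi,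
    collinear_iff_eq_or_eq_or_angle_eq_zero_or_angle_eq_pi, angle_map_dilationEquiv,
    f.injective.eq_iff, f.injective.eq_iff]

theorem AnglesMem.image {T : Set ℝ} {S : Set P} (h : AnglesMem T S) (f : P ≃ᵈ Q) :
    AnglesMem T (f '' S) := by
  rintro _ ⟨a, ha, rfl⟩ _ ⟨b, hb, rfl⟩ _ ⟨c, hc, rfl⟩ hab hbc hac hπ
  rw [angle_map_dilationEquiv] at hπ ⊢
  exact h a ha b hb c hc (fun e => hab (e ▸ rfl)) (fun e => hbc (e ▸ rfl))
    (fun e => hac (e ▸ rfl)) hπ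

theorem AnglesMem.angle_mem {T : Set ℝ} {S : Set P} (h : AnglesMem T S) {a b c : P}
    (ha : a ∈ S) (hb : b ∈ S) (hc : c ∈ S) (habc : ¬ Collinear ℝ {a, b, c}) : ∠ a b c ∈ T :=
  h a ha b hb c hc (ne₁₂_of_not_collinear habc) (ne₂₃_of_not_collinear habc)
    (ne₁₃_of_not_collinear habc) (angle_ne_pi_of_not_collinear habc)

theorem not_collinear_rotate {a b c : P} (h : ¬ Collinear ℝ {a, b, c}) :
    ¬ Collinear ℝ {b, c, a} := by
  rwa [Set.pair_comm c a, Set.insert_comm b a]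

theorem not_collinear_iff_exists_triple {S : Set P} :
    ¬ Collinear ℝ S ↔ ∃ a ∈ S, ∃ b ∈ S, ∃ c ∈ S, ¬ Collinear ℝ {a, b, c} := by
  constructor
  · intro h
    by_contra! hS
    have hne : S.Nontrivial := by
      by_contra hs
      obtain rfl | ⟨x, rfl⟩ := (Set.not_nontrivial_iff.1 hs).eq_empty_or_singleton
      · exact h (collinear_empty ℝ P)
      · exact h (collinear_singleton ℝ x)
    obtain ⟨a, ha, b, hb, hab⟩ := hne
    refine h ((collinear_iff_of_mem ha).2 ⟨b -ᵥ a, fun p hp => ?_⟩)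
    obtain ⟨v, hv⟩ := (collinear_iff_of_mem (p₀ := a) (by simp)).1 (hS a ha b hb p hp)
    obtain ⟨s, hs⟩ := hv b (by simp)
    obtain ⟨r, hr⟩ := hv p (by simp)
    have hs0 : s ≠ 0 := by
      rintro rfl
      exact hab (by simp [hs])
    refine ⟨r / s, ?_⟩
    rw [hr, hs, vadd_vsub, smul_smul, div_mul_cancel₀ _ hs0]
  · rintro ⟨a, ha, b, hb, c, hc, h⟩ hS
    exact h (hS.subset (by rintro x (rfl | rfl | rfl) <;> assumption))

theorem not_collinear_image {S : Set P} (h : ¬ Collinear ℝ S) (f : P ≃ᵈ Q) :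
    ¬ Collinear ℝ (f '' S) := by
  obtain ⟨a, ha, b, hb, c, hc, h⟩ := not_collinear_iff_exists_triple.1 h
  exact not_collinear_iff_exists_triple.2 ⟨f a, ⟨a, ha, rfl⟩, f b, ⟨b, hb, rfl⟩, f c, ⟨c, hc, rfl⟩,
    (collinear_map_dilationEquiv_iff f).not.2 h⟩

end Similarities

/-- Among four members of a set of at most three elements, two are equal. -/
theorem exists_eq_of_encard_le_three {α : Type*} {T : Set α} (hT : T.encard ≤ 3) {a b c d : α}
    (ha : a ∈ T) (hb : b ∈ T) (hc : c ∈ T) (hd : d ∈ T) :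
    a = b ∨ a = c ∨ a = d ∨ b = c ∨ b = d ∨ c = d := by
  by_contra! h
  obtain ⟨h1, h2, h3, h4, h5, h6⟩ := h
  have hs : ({a, b, c, d} : Set α) ⊆ T := by
    rintro x (rfl | rfl | rfl | rfl) <;> assumption
  have h7 : ({a, b, c, d} : Set α).encard = 4 := by
    rw [Set.encard_insert_of_notMem (by simp [*]), Set.encard_insert_of_notMem (by simp [*]),
      Set.encard_pair h6]
    norm_num
  have := (Set.encard_le_encard hs).trans hT
  rw [h7] at this
  exact absurd this (by decide)

/-- Collinearity of complex numbers in terms of a real parameter on the line through `b` and `c`. -/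
theorem collinear_triple_iff {a b c : ℂ} (hbc : c ≠ b) :
    Collinear ℝ {a, b, c} ↔ ∃ r : ℝ, a = b + r * (c - b) := by
  rw [collinear_iff_of_mem (p₀ := b) (by simp)]
  have hcb : c - b ≠ 0 := sub_ne_zero.2 hbc
  constructor
  · rintro ⟨v, hv⟩
    obtain ⟨r, hr⟩ := hv a (by simp)
    obtain ⟨s, hs⟩ := hv c (by simp)
    simp only [Complex.real_smul, vadd_eq_add] at hr hs
    have hs0 : (s : ℂ) ≠ 0 := by
      rintro h
      rw [h] at hs
      exact hbc (by simpa using hs)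
    refine ⟨r / s, ?_⟩
    rw [hr, hs]
    push_cast
    field_simp
    ring
  · rintro ⟨r, hr⟩
    refine ⟨c - b, ?_⟩
    rintro p (rfl | rfl | rfl)
    · exact ⟨r, by simp [hr, add_comm]⟩
    · exact ⟨0, by simp⟩
    · exact ⟨1, by simp⟩

theorem angle_eq_abs_arg_div {a b c : ℂ} (hab : a ≠ b) (hcb : c ≠ b) :
    ∠ a b c = |((a - b) / (c - b)).arg| := by
  unfold EuclideanGeometry.angle
  exact Complex.angle_eq_abs_arg (sub_ne_zero.2 hab) (sub_ne_zero.2 hcb)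

/-! ### Sets with a collinear triple -/

/-- The arithmetic of two triangles `p b c` and `p b a` with `b` between `a` and `c`: `y` and
`y'` are the angles at `b`, and `z`, `s` and `x`, `w` are the others, each pair adding up to an
exterior angle. -/
theorem angles_eq_of_add_eq {T : Set ℝ} (hT : T.encard ≤ 3) {y y' z s x w : ℝ} (h0 : 0 ∈ T)
    (hy : y ∈ T) (hy' : y' ∈ T) (hz : z ∈ T) (hs : s ∈ T) (hx : x ∈ T) (hw : w ∈ T)
    (hz0 : 0 < z) (hs0 : 0 < s) (hx0 : 0 < x) (hw0 : 0 < w)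
    (h : y' + y = π) (h₁ : z + s = y') (h₂ : x + w = y) :
    y = π / 2 ∧ z = π / 4 ∧ s = π / 4 ∧ x = π / 4 ∧ w = π / 4 := by
  have key : ∀ {a : ℝ}, a ∈ T → 0 < a → y = y' ∨ a = y ∨ a = y' := by
    intro a ha ha0
    rcases exists_eq_of_encard_le_three hT h0 hy hy' ha with e | e | e | e | e | e <;>
      first
        | exact absurd e (by linarith)
        | exact Or.inl e
        | exact Or.inr (Or.inl e.symm)
        | exact Or.inr (Or.inr e.symm)
  by_cases hyy : y = y'
  · have hzs : z = s := by
      rcases exists_eq_of_encard_le_three hT h0 hy hz hs with e | e | e | e | e | e <;> linarith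
    have hxw : x = w := by
      rcases exists_eq_of_encard_le_three hT h0 hy hx hw with e | e | e | e | e | e <;> linarith
    refine ⟨?_, ?_, ?_, ?_, ?_⟩ <;> linarith
  · exfalso
    rcases key hz hz0 with e | e | e <;> rcases key hs hs0 with e' | e' | e' <;>
      rcases key hx hx0 with e₁ | e₁ | e₁ <;> rcases key hw hw0 with e₂ | e₂ | e₂ <;>
      first | contradiction | linarith

theorem eq_I_or_eq_neg_I {q : ℂ} (h : ‖q‖ = 1) (ha : |q.arg| = π / 2) :
    q = Complex.I ∨ q = -Complex.I := by
  have hq := Complex.norm_mul_exp_arg_mul_I q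
  rw [h] at hq
  rcases eq_or_eq_neg_of_abs_eq ha with e | e <;> rw [e] at hq
  · left
    rw [← hq]; push_cast; rw [Complex.exp_pi_div_two_mul_I]; simp
  · right
    rw [← hq]; push_cast; rw [← neg_div, Complex.exp_neg_pi_div_two_mul_I]; simp

/-- If at most three angles other than `π` occur, then a point `p` off the line of a collinear
triple forms right isosceles triangles with its middle point and either outer point. -/
theorem right_isosceles_of_sbtw {T : Set ℝ} (hT : T.encard ≤ 3) {S : Set ℂ} (hS : AnglesMem T S)
    {a b c p : ℂ} (ha : a ∈ S) (hb : b ∈ S) (hc : c ∈ S) (hp : p ∈ S) (habc : Sbtw ℝ a b c)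
    (hpbc : ¬ Collinear ℝ {p, b, c}) :
    a + c = 2 * b ∧ (p - b = Complex.I * (c - b) ∨ p - b = -Complex.I * (c - b)) := by
  have hab : a ≠ b := habc.left_ne
  have hcb : c ≠ b := habc.right_ne
  have hpba : ¬ Collinear ℝ {p, b, a} := by
    intro h
    obtain ⟨r, hr⟩ := (collinear_triple_iff hab).1 h
    obtain ⟨s, hs⟩ := (collinear_triple_iff hcb).1 habc.wbtw.collinear
    apply hpbc
    refine (collinear_triple_iff hcb).2 ⟨r * s, ?_⟩
    rw [hr, hs]; push_cast; ring
  have hbcp := not_collinear_rotate hpbc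
  have hcpb := not_collinear_rotate hbcp
  have hbap := not_collinear_rotate hpba
  have hapb := not_collinear_rotate hbap
  have hpb : p ≠ b := ne₁₂_of_not_collinear hpbc
  have hpa : a ≠ p := ne₁₂_of_not_collinear hapb
  have hpc : c ≠ p := ne₁₂_of_not_collinear hcpb
  have h0 : (0 : ℝ) ∈ T := by
    have h := habc.angle₂₁₃_eq_zero
    rw [← h]
    exact hS b hb a ha c hc hab.symm habc.left_ne_right hcb.symm
      (by rw [h]; exact Real.pi_ne_zero.symm)
  have hπ := angle_add_angle_eq_pi_of_angle_eq_pi p habc.angle₁₂₃_eq_pi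
  have hsc := angle_add_angle_add_angle_eq_pi c hpb.symm
  have hsa := angle_add_angle_add_angle_eq_pi a hpb.symm
  obtain ⟨h₁, h₂, h₃, h₄, h₅⟩ := angles_eq_of_add_eq hT h0 (hS.angle_mem hp hb hc hpbc)
    (hS.angle_mem hp hb ha hpba) (hS.angle_mem hb hc hp hbcp) (hS.angle_mem hc hp hb hcpb)
    (hS.angle_mem hb ha hp hbap) (hS.angle_mem ha hp hb hapb) (angle_pos_of_not_collinear hbcp)
    (angle_pos_of_not_collinear hcpb) (angle_pos_of_not_collinear hbap)
    (angle_pos_of_not_collinear hapb) (by linarith) (by linarith) (by linarith)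
  have hdc : dist b c = dist b p := by
    apply dist_eq_of_angle_eq_angle_of_angle_ne_pi (by rw [h₂, angle_comm, h₃])
    rw [angle_comm]; exact angle_ne_pi_of_not_collinear hpbc
  have hda : dist b a = dist b p := by
    apply dist_eq_of_angle_eq_angle_of_angle_ne_pi (by rw [h₄, angle_comm, h₅])
    rw [angle_comm]; exact angle_ne_pi_of_not_collinear hpba
  rw [dist_comm, Complex.dist_eq, dist_comm b, Complex.dist_eq] at hdc hda
  have hcb0 : c - b ≠ 0 := sub_ne_zero.2 hcb
  have hn : ‖c - b‖ ≠ 0 := norm_ne_zero_iff.2 hcb0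
  constructor
  · have h := habc.angle₁₂₃_eq_pi
    rw [angle_eq_abs_arg_div hab hcb] at h
    have hq := Complex.norm_mul_exp_arg_mul_I ((a - b) / (c - b))
    have harg : ((a - b) / (c - b)).arg = π := by
      rcases eq_or_eq_neg_of_abs_eq h with e | e
      · exact e
      · exact absurd e (Complex.neg_pi_lt_arg _).ne'
    rw [harg, Complex.exp_pi_mul_I, norm_div, hda, ← hdc, div_self hn, Complex.ofReal_one, one_mul,
      eq_div_iff hcb0] at hq
    linear_combination -hq
  · rw [angle_eq_abs_arg_div hpb hcb] at h₁
    have hq : ‖(p - b) / (c - b)‖ = 1 := by rw [norm_div, ← hdc, div_self hn]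
    rcases eq_I_or_eq_neg_I hq h₁ with e | e
    · exact Or.inl ((div_eq_iff hcb0).1 e)
    · exact Or.inr ((div_eq_iff hcb0).1 e)

theorem mul_one_add_mul_I_ne_zero {u : ℂ} (hu : u ≠ 0) (k : ℝ) : u * (1 + k * Complex.I) ≠ 0 := by
  refine mul_ne_zero hu fun h => ?_
  simpa using congrArg Complex.re h

/-- A set with a collinear triple and at most three angles lies in a square with its centre. -/
theorem exists_subset_square_of_sbtw {T : Set ℝ} (hT : T.encard ≤ 3) {S : Set ℂ}
    (hS : AnglesMem T S) (hcol : ¬ Collinear ℝ S) {a b c : ℂ} (ha : a ∈ S) (hb : b ∈ S)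
    (hc : c ∈ S) (habc : Sbtw ℝ a b c) :
    ∃ b u : ℂ, u ≠ 0 ∧
      S ⊆ {b + u, b + Complex.I * u, b - u, b - Complex.I * u, b} := by
  have hcb : c ≠ b := habc.right_ne
  have hcb0 : c - b ≠ 0 := sub_ne_zero.2 hcb
  obtain ⟨p, hp, hpbc⟩ : ∃ p ∈ S, ¬ Collinear ℝ {p, b, c} := by
    by_contra! h
    refine hcol ((collinear_iff_of_mem hb).2 ⟨c - b, fun q hq => ?_⟩)
    obtain ⟨r, hr⟩ := (collinear_triple_iff hcb).1 (h q hq)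
    exact ⟨r, by simp [hr, add_comm]⟩
  have key : ∀ q ∈ S, ¬ Collinear ℝ {q, b, c} → a + c = 2 * b ∧
      (q - b = Complex.I * (c - b) ∨ q - b = -Complex.I * (c - b)) := fun q hq h =>
    right_isosceles_of_sbtw hT hS ha hb hc hq habc h
  obtain ⟨hac, hpI⟩ := key p hp hpbc
  refine ⟨b, c - b, hcb0, fun q hq => ?_⟩
  by_cases hqbc : Collinear ℝ {q, b, c}
  · obtain ⟨r, hr⟩ := (collinear_triple_iff hcb).1 hqbc
    -- another triple on the line puts `p` perpendicularly above its own middle point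
    have hpr : ∀ {x y z : ℂ}, x ∈ S → y ∈ S → z ∈ S → Collinear ℝ {y, b, c} →
        Collinear ℝ {z, b, c} → Sbtw ℝ x y z → x + z = 2 * y ∧
          (p - y = Complex.I * (z - y) ∨ p - y = -Complex.I * (z - y)) := by
      intro x y z hx hy hz hyl hzl h
      refine right_isosceles_of_sbtw hT hS hx hy hz hp h fun hpyz => hpbc ?_
      obtain ⟨s, hs⟩ := (collinear_triple_iff h.right_ne).1 hpyz
      obtain ⟨t, ht⟩ := (collinear_triple_iff hcb).1 hyl
      obtain ⟨v, hv⟩ := (collinear_triple_iff hcb).1 hzl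
      refine (collinear_triple_iff hcb).2 ⟨t + s * (v - t), ?_⟩
      rw [hs, hv, ht]; push_cast; ring
    by_cases hqb : q = b
    · simp [hqb]
    by_cases hqc : q = c
    · simp [hqc]
    have hbl : Collinear ℝ {b, b, c} := by simpa using collinear_pair ℝ b c
    have hcl : Collinear ℝ {c, b, c} := by
      rw [Set.insert_comm, Set.pair_eq_singleton]; exact collinear_pair ℝ b c
    rcases hqbc.wbtw_or_wbtw_or_wbtw with h | h | h
    · obtain ⟨h₁, -⟩ := hpr hq hb hc hbl hcl ⟨h, Ne.symm hqb, hcb.symm⟩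
      right; right; left
      linear_combination h₁
    · exfalso
      obtain ⟨h₁, h₂⟩ := hpr hb hc hq hcl hqbc ⟨h, hcb, Ne.symm hqc⟩
      have hq : q = 2 * c - b := by linear_combination h₁
      subst hq
      rcases hpI with e | e <;> rcases h₂ with e' | e'
      · exact mul_one_add_mul_I_ne_zero hcb0 0 (by push_cast; linear_combination e - e')
      · exact mul_one_add_mul_I_ne_zero hcb0 (-2) (by push_cast; linear_combination e - e')
      · exact mul_one_add_mul_I_ne_zero hcb0 2 (by push_cast; linear_combination e - e')
      · exact mul_one_add_mul_I_ne_zero hcb0 0 (by push_cast; linear_combination e - e')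
    · exfalso
      obtain ⟨h₁, h₂⟩ := hpr hc hq hb hqbc hbl ⟨h, hqc, hqb⟩
      have hq : q = (c + b) / 2 := by linear_combination (-1 / 2) * h₁
      subst hq
      rcases hpI with e | e <;> rcases h₂ with e' | e'
      · exact mul_one_add_mul_I_ne_zero hcb0 (-3) (by push_cast; linear_combination 2 * e - 2 * e')
      · exact mul_one_add_mul_I_ne_zero hcb0 (-1) (by push_cast; linear_combination 2 * e - 2 * e')
      · exact mul_one_add_mul_I_ne_zero hcb0 1 (by push_cast; linear_combination 2 * e - 2 * e')
      · exact mul_one_add_mul_I_ne_zero hcb0 3 (by push_cast; linear_combination 2 * e - 2 * e')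
  · obtain ⟨-, h | h⟩ := key q hq hqbc
    · right; left
      linear_combination h
    · right; right; right; left
      linear_combination h

/-! ### Arguments of complex numbers and sides of a line -/

theorem arg_div_eq_sub {x y : ℂ} (hx : x ≠ 0) (hy : y ≠ 0) (h : x.arg - y.arg ∈ Set.Ioc (-π) π) :
    (x / y).arg = x.arg - y.arg := by
  have := congrArg Real.Angle.toReal (Complex.arg_div_coe_angle hx hy)
  rwa [← Real.Angle.coe_sub, Complex.arg_coe_angle_toReal_eq_arg,
    Real.Angle.toReal_coe_eq_self_iff_mem_Ioc.2 h] at this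

theorem abs_arg_mul_of_im_pos {x y : ℂ} (hx : 0 < x.im) (hy : 0 < y.im) :
    |(x * y).arg| = |x.arg| + |y.arg| ∨ |(x * y).arg| = 2 * π - (|x.arg| + |y.arg|) := by
  have hx0 : x ≠ 0 := by rintro rfl; simp at hx
  have hy0 : y ≠ 0 := by rintro rfl; simp at hy
  have h := Complex.arg_mul_coe_angle hx0 hy0
  rw [← Real.Angle.coe_add, Real.Angle.angle_eq_iff_two_pi_dvd_sub] at h
  obtain ⟨k, hk⟩ := h
  have h1 := Complex.neg_pi_lt_arg (x * y)
  have h2 := Complex.arg_le_pi (x * y)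
  have h3 := Complex.arg_nonneg_iff.2 hx.le
  have h4 := Complex.arg_nonneg_iff.2 hy.le
  have h5 := Complex.arg_le_pi x
  have h6 := Complex.arg_le_pi y
  have hπ := Real.pi_pos
  rw [abs_of_nonneg h3, abs_of_nonneg h4]
  have hk1 : k < 1 := by
    by_contra! hk1
    have : (1 : ℝ) ≤ k := by exact_mod_cast hk1
    nlinarith
  have hk2 : -2 < k := by
    by_contra! hk2
    have : (k : ℝ) ≤ -2 := by exact_mod_cast hk2
    nlinarith
  obtain rfl | rfl : k = 0 ∨ k = -1 := by omega
  · left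
    push_cast at hk
    rw [abs_of_nonneg] <;> linarith
  · right
    push_cast at hk
    rw [abs_of_nonpos] <;> linarith

theorem abs_arg_conj (z : ℂ) : |((starRingEnd ℂ) z).arg| = |z.arg| := by
  rw [Complex.arg_conj]
  split_ifs with h
  · rw [h]
  · rw [abs_neg]

theorem abs_arg_mul_of_im_mul_im_pos {x y : ℂ} (h : 0 < x.im * y.im) :
    |(x * y).arg| = |x.arg| + |y.arg| ∨ |(x * y).arg| = 2 * π - (|x.arg| + |y.arg|) := by
  rcases mul_pos_iff.1 h with ⟨hx, hy⟩ | ⟨hx, hy⟩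
  · exact abs_arg_mul_of_im_pos hx hy
  · have := @abs_arg_mul_of_im_pos ((starRingEnd ℂ) x) ((starRingEnd ℂ) y) (by simpa) (by simpa)
    simpa only [← map_mul, abs_arg_conj] using this

theorem eq_of_abs_arg_eq {x y : ℂ} (h : 0 < x.im * y.im) (hxy : |x.arg| = |y.arg|) :
    x.arg = y.arg := by
  rcases mul_pos_iff.1 h with ⟨hx, hy⟩ | ⟨hx, hy⟩
  · rwa [abs_of_nonneg (Complex.arg_nonneg_iff.2 hx.le),
      abs_of_nonneg (Complex.arg_nonneg_iff.2 hy.le)] at hxy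
  · rw [abs_of_neg (Complex.arg_neg_iff.2 hx), abs_of_neg (Complex.arg_neg_iff.2 hy)] at hxy
    linarith

/-- The sign of the imaginary part of `(0 - x) / (p - x)` tells on which
side of the line through `0` and `x` the point `p` lies. -/
theorem im_div_sub (x p : ℂ) (hx : x ≠ 0) :
    ((0 - x) / (p - x)).im = (p / x).im / Complex.normSq (1 - p / x) := by
  have : (0 - x) / (p - x) = (1 - p / x)⁻¹ := by
    rw [one_sub_div hx, inv_div, ← neg_div_neg_eq]; ring
  rw [this, Complex.inv_im]
  simp

/-- Two points on the same side of the line through `0` and `x` that are seen from `x` at equal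
angles to `0` lie on one ray from `x`. -/
theorem collinear_of_angle_eq_of_same_side {x p q : ℂ} (hx : x ≠ 0)
    (h : 0 < (p / x).im * (q / x).im) (ha : ∠ 0 x p = ∠ 0 x q) : Collinear ℝ {x, p, q} := by
  have hp : p ≠ x := by rintro rfl; simp [hx] at h
  have hq : q ≠ x := by rintro rfl; simp [hx] at h
  have hp' : 1 - p / x ≠ 0 := by rw [one_sub_div hx]; exact div_ne_zero (sub_ne_zero.2 hp.symm) hx
  have hq' : 1 - q / x ≠ 0 := by rw [one_sub_div hx]; exact div_ne_zero (sub_ne_zero.2 hq.symm) hx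
  rw [angle_eq_abs_arg_div hx.symm hp, angle_eq_abs_arg_div hx.symm hq] at ha
  have harg := eq_of_abs_arg_eq (by
    rw [im_div_sub x p hx, im_div_sub x q hx, div_mul_div_comm]
    exact div_pos h (mul_pos (Complex.normSq_pos.2 hp') (Complex.normSq_pos.2 hq'))) ha
  have h0 : ∠ p x q = 0 := by
    rw [angle_eq_abs_arg_div hp hq]
    have : (p - x) / (q - x) = ((0 - x) / (q - x)) / ((0 - x) / (p - x)) := by
      have := sub_ne_zero.2 hp
      have := sub_ne_zero.2 hq
      have : 0 - x ≠ 0 := by simpa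
      field_simp
    have h1 : (0 - x) / (q - x) ≠ 0 := div_ne_zero (by simpa) (sub_ne_zero.2 hq)
    have h2 : (0 - x) / (p - x) ≠ 0 := div_ne_zero (by simpa) (sub_ne_zero.2 hp)
    rw [this, arg_div_eq_sub h1 h2, harg, sub_self, abs_zero]
    rw [harg, sub_self]
    exact ⟨neg_lt_zero.2 Real.pi_pos, Real.pi_pos.le⟩
  rw [Set.insert_comm]
  exact collinear_of_angle_eq_zero h0

/-- The angle at `x` between points on different sides of the line through `0` and `x`. -/
theorem angle_eq_add_of_opposite_sides {x p q : ℂ} (hx : x ≠ 0)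
    (h : (p / x).im * (q / x).im < 0) :
    ∠ p x q = ∠ 0 x p + ∠ 0 x q ∨ ∠ p x q = 2 * π - (∠ 0 x p + ∠ 0 x q) := by
  have hp : p ≠ x := by rintro rfl; simp [hx] at h
  have hq : q ≠ x := by rintro rfl; simp [hx] at h
  have hp' : 1 - p / x ≠ 0 := by rw [one_sub_div hx]; exact div_ne_zero (sub_ne_zero.2 hp.symm) hx
  have hq' : 1 - q / x ≠ 0 := by rw [one_sub_div hx]; exact div_ne_zero (sub_ne_zero.2 hq.symm) hx
  rw [angle_comm 0 x p, angle_eq_abs_arg_div hp hx.symm, angle_eq_abs_arg_div hx.symm hq,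
    angle_eq_abs_arg_div hp hq]
  have hpx := sub_ne_zero.2 hp
  have hqx := sub_ne_zero.2 hq
  have hx' : 0 - x ≠ 0 := by simpa
  have e : (p - x) / (q - x) = ((p - x) / (0 - x)) * ((0 - x) / (q - x)) := by field_simp
  rw [e]
  apply abs_arg_mul_of_im_mul_im_pos
  have e' : (p - x) / (0 - x) = 1 - p / x := by field_simp; ring
  rw [im_div_sub x q hx, e', mul_div_assoc']
  refine div_pos ?_ (Complex.normSq_pos.2 hq')
  simp only [Complex.sub_im, Complex.one_im]
  linarith

/-- The angles of the points `0, 1, z₁, z₂, z₃` as multiples of the smallest one, with `π` equal to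
`m` such units: `a` and `b` are the angles at `1` and at `z₃`, and `c`, `d`, `e` those at `z₁` and
`z₂`. The angles `c` and `d` lie on different sides of a line, so `e` is their sum or completes it
to a full turn. Only the angles of the regular pentagon are possible. -/
theorem multiples_eq {m a₁ a₂ a₃ b₀ b₁ b₂ c₁ c₂ d₁ d₂ e₁ e₂ : ℕ}
    (ha₁ : a₁ ∈ Set.Icc 1 3) (ha₂ : a₂ ∈ Set.Icc 1 3) (ha₃ : a₃ ∈ Set.Icc 1 3)
    (hb₀ : b₀ ∈ Set.Icc 1 3) (hb₁ : b₁ ∈ Set.Icc 1 3) (hb₂ : b₂ ∈ Set.Icc 1 3)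
    (hc₁ : c₁ ∈ Set.Icc 1 3) (hc₂ : c₂ ∈ Set.Icc 1 3)
    (hd₁ : d₁ ∈ Set.Icc 1 3) (hd₂ : d₂ ∈ Set.Icc 1 3)
    (he₁ : e₁ ∈ Set.Icc 1 3) (he₂ : e₂ ∈ Set.Icc 1 3)
    (a12 : a₁ ≠ a₂) (a13 : a₁ ≠ a₃) (a23 : a₂ ≠ a₃)
    (b01 : b₀ ≠ b₁) (b02 : b₀ ≠ b₂) (b12 : b₁ ≠ b₂)
    (h : 3 + a₃ + b₀ = m) (hac₁ : 1 + a₁ + c₁ = m) (hac₂ : 2 + a₂ + c₂ = m)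
    (hbd₁ : 2 + b₁ + d₁ = m) (hbd₂ : 1 + b₂ + d₂ = m)
    (h₁ : e₁ = c₁ + d₁ ∨ e₁ + (c₁ + d₁) = 2 * m) (h₂ : e₂ = c₂ + d₂ ∨ e₂ + (c₂ + d₂) = 2 * m) :
    m = 5 ∧ a₁ = 3 ∧ a₂ = 2 ∧ a₃ = 1 := by
  simp only [Set.mem_Icc] at *
  omega

/-! ### Five points in general position: the angles -/

/-- If `0 < t₁ < t₂ < t₃` and the differences of these four numbers take only three values, then
they are equally spaced, and the three values are the first three multiples of `t₁`. -/
theorem subset_of_sub_mem {T : Set ℝ} (hT : T.encard ≤ 3) {t₁ t₂ t₃ : ℝ} (h0 : 0 < t₁)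
    (h12 : t₁ < t₂) (h23 : t₂ < t₃) (h₁ : t₁ ∈ T) (h₂ : t₂ ∈ T) (h₃ : t₃ ∈ T)
    (h₂₁ : t₂ - t₁ ∈ T) (h₃₁ : t₃ - t₁ ∈ T) :
    t₂ = 2 * t₁ ∧ t₃ = 3 * t₁ ∧ ∀ x ∈ T, ∃ n : ℕ, n ∈ Set.Icc 1 3 ∧ x = n * t₁ := by
  have key : ∀ x ∈ T, x = t₁ ∨ x = t₂ ∨ x = t₃ := by
    intro x hx
    rcases exists_eq_of_encard_le_three hT h₁ h₂ h₃ hx with e | e | e | e | e | e <;>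
      first
        | exact absurd e (by linarith)
        | exact Or.inl e.symm
        | exact Or.inr (Or.inl e.symm)
        | exact Or.inr (Or.inr e.symm)
  have h : t₂ = 2 * t₁ ∧ t₃ = 3 * t₁ := by
    rcases key _ h₂₁ with e | e | e <;> rcases key _ h₃₁ with e' | e' | e' <;>
      first
        | exact absurd e (by linarith)
        | exact absurd e' (by linarith)
        | exact ⟨by linarith, by linarith⟩
  refine ⟨h.1, h.2, fun x hx => ?_⟩
  rcases key x hx with e | e | e
  · exact ⟨1, by simp, by simp [e]⟩
  · exact ⟨2, by simp, by rw [e, h.1]; norm_num⟩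
  · exact ⟨3, by simp, by rw [e, h.2]; norm_num⟩

theorem angle_zero_eq_sub {x y : ℂ} (hx : x ≠ 0) (hy : y ≠ 0) (h0 : 0 ≤ x.arg)
    (hxy : x.arg < y.arg) : ∠ x 0 y = y.arg - x.arg := by
  have h := Complex.arg_le_pi y
  have hπ := Real.pi_pos
  rw [angle_comm, angle_eq_abs_arg_div hy hx, sub_zero, sub_zero, arg_div_eq_sub hy hx,
    abs_of_pos (by linarith)]
  constructor <;> linarith

theorem im_div_pos {x y : ℂ} (hx : x ≠ 0) (hy : y ≠ 0) (h0 : 0 ≤ x.arg) (hxy : x.arg < y.arg)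
    (hyπ : y.arg < π) : 0 < (y / x).im := by
  have h := arg_div_eq_sub hy hx ⟨by linarith [Real.pi_pos], by linarith⟩
  have h1 : 0 ≤ (y / x).arg := by rw [h]; linarith
  refine lt_of_le_of_ne (Complex.arg_nonneg_iff.1 h1) fun h2 => ?_
  have h3 : (y / x).arg ≠ 0 := by rw [h]; linarith
  have h4 : (y / x).arg ≠ π := by rw [h]; linarith
  rcases le_or_gt 0 (y / x).re with h5 | h5
  · exact h3 (Complex.arg_eq_zero_iff.2 ⟨h5, h2.symm⟩)
  · exact h4 (Complex.arg_eq_pi_iff.2 ⟨h5, h2.symm⟩)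

theorem im_div_neg {x y : ℂ} (hx : x ≠ 0) (hy : y ≠ 0) (h0 : 0 ≤ x.arg) (hxy : x.arg < y.arg)
    (hyπ : y.arg < π) : (x / y).im < 0 := by
  have h := im_div_pos hx hy h0 hxy hyπ
  have e : (x / y).im = -(y / x).im / Complex.normSq (y / x) := by
    rw [← inv_div, Complex.inv_im]
  rw [e]
  exact div_neg_of_neg_of_pos (neg_lt_zero.2 h) (Complex.normSq_pos.2 (div_ne_zero hy hx))

/-- Five points in general position with few angles, normalized so that `0` sees the others in a
half-plane, with `1` in the first direction: each of the other points lies on a known ray from `0`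
and on a known ray from `1`. -/
theorem angles_determined {T : Set ℝ} (hT : T.encard ≤ 3) {S : Set ℂ} (hS : AnglesMem T S)
    (hcol : ∀ a ∈ S, ∀ b ∈ S, ∀ c ∈ S, a ≠ b → b ≠ c → a ≠ c → ¬ Collinear ℝ {a, b, c})
    {z₁ z₂ z₃ : ℂ} (hz : 0 ∈ S) (hz₀ : 1 ∈ S) (hz₁ : z₁ ∈ S) (hz₂ : z₂ ∈ S) (hz₃ : z₃ ∈ S)
    (n₁ : z₁ ≠ 0) (n₂ : z₂ ≠ 0) (n₃ : z₃ ≠ 0)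
    (h01 : 0 < z₁.arg) (h12 : z₁.arg < z₂.arg) (h23 : z₂.arg < z₃.arg) (h3 : z₃.arg < π) :
    (z₁.arg = π / 5 ∧ ∠ 0 1 z₁ = 3 * (π / 5)) ∧
    (z₂.arg = 2 * (π / 5) ∧ ∠ 0 1 z₂ = 2 * (π / 5)) ∧
    (z₃.arg = 3 * (π / 5) ∧ ∠ 0 1 z₃ = π / 5) := by
  have m0 : (1 : ℂ) ≠ 0 := one_ne_zero
  have arg1 : (1 : ℂ).arg = 0 := Complex.arg_one
  have e₁ : (1 : ℂ) ≠ z₁ := by rintro rfl; linarith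
  have e₂ : (1 : ℂ) ≠ z₂ := by rintro rfl; linarith
  have e₃ : (1 : ℂ) ≠ z₃ := by rintro rfl; linarith
  have e₁₂ : z₁ ≠ z₂ := by rintro rfl; linarith
  have e₁₃ : z₁ ≠ z₃ := by rintro rfl; linarith
  have e₂₃ : z₂ ≠ z₃ := by rintro rfl; linarith
  have mem : ∀ {a b c : ℂ}, a ∈ S → b ∈ S → c ∈ S → a ≠ b → b ≠ c → a ≠ c → ∠ a b c ∈ T :=
    fun ha hb hc hab hbc hac => hS.angle_mem ha hb hc (hcol _ ha _ hb _ hc hab hbc hac)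
  have t₁ := angle_zero_eq_sub m0 n₁ arg1.ge (by rwa [arg1])
  have t₂ := angle_zero_eq_sub m0 n₂ arg1.ge (by rw [arg1]; linarith)
  have t₃ := angle_zero_eq_sub m0 n₃ arg1.ge (by rw [arg1]; linarith)
  have t₁₂ := angle_zero_eq_sub n₁ n₂ h01.le h12
  have t₁₃ := angle_zero_eq_sub n₁ n₃ h01.le (by linarith)
  have t₂₃ := angle_zero_eq_sub n₂ n₃ (by linarith) h23
  rw [arg1, sub_zero] at t₁ t₂ t₃
  obtain ⟨r₂, r₃, hmul⟩ := subset_of_sub_mem hT h01 h12 h23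
    (t₁ ▸ mem hz₀ hz hz₁ m0 n₁.symm e₁) (t₂ ▸ mem hz₀ hz hz₂ m0 n₂.symm e₂)
    (t₃ ▸ mem hz₀ hz hz₃ m0 n₃.symm e₃) (t₁₂ ▸ mem hz₁ hz hz₂ n₁ n₂.symm e₁₂)
    (t₁₃ ▸ mem hz₁ hz hz₃ n₁ n₃.symm e₁₃)
  set α := z₁.arg with hα
  rw [r₂] at t₂ t₁₂
  rw [r₃] at t₃ t₁₃
  rw [r₂, r₃] at t₂₃
  obtain ⟨a₁, ha₁, qa₁⟩ := hmul _ (mem hz hz₀ hz₁ m0.symm e₁ n₁.symm)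
  obtain ⟨a₂, ha₂, qa₂⟩ := hmul _ (mem hz hz₀ hz₂ m0.symm e₂ n₂.symm)
  obtain ⟨a₃, ha₃, qa₃⟩ := hmul _ (mem hz hz₀ hz₃ m0.symm e₃ n₃.symm)
  obtain ⟨b₀, hb₀, qb₀⟩ := hmul _ (mem hz hz₃ hz₀ n₃.symm e₃.symm m0.symm)
  obtain ⟨b₁, hb₁, qb₁⟩ := hmul _ (mem hz hz₃ hz₁ n₃.symm e₁₃.symm n₁.symm)
  obtain ⟨b₂, hb₂, qb₂⟩ := hmul _ (mem hz hz₃ hz₂ n₃.symm e₂₃.symm n₂.symm)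
  obtain ⟨c₁, hc₁, qc₁⟩ := hmul _ (mem hz hz₁ hz₀ n₁.symm e₁.symm m0.symm)
  obtain ⟨c₂, hc₂, qc₂⟩ := hmul _ (mem hz hz₂ hz₀ n₂.symm e₂.symm m0.symm)
  obtain ⟨d₁, hd₁, qd₁⟩ := hmul _ (mem hz hz₁ hz₃ n₁.symm e₁₃ n₃.symm)
  obtain ⟨d₂, hd₂, qd₂⟩ := hmul _ (mem hz hz₂ hz₃ n₂.symm e₂₃ n₃.symm)
  obtain ⟨f₁, hf₁, qf₁⟩ := hmul _ (mem hz₀ hz₁ hz₃ e₁ e₁₃ e₃)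
  obtain ⟨f₂, hf₂, qf₂⟩ := hmul _ (mem hz₀ hz₂ hz₃ e₂ e₂₃ e₃)
  have s := angle_add_angle_add_angle_eq_pi z₃ m0
  have sc₁ := angle_add_angle_add_angle_eq_pi z₁ m0
  have sc₂ := angle_add_angle_add_angle_eq_pi z₂ m0
  have sd₁ := angle_add_angle_add_angle_eq_pi z₁ n₃
  have sd₂ := angle_add_angle_add_angle_eq_pi z₂ n₃
  rw [angle_comm z₃ 0 1, angle_comm 1 z₃ 0, qa₃, qb₀, t₃] at s
  rw [angle_comm z₁ 0 1, angle_comm 1 z₁ 0, qa₁, qc₁, t₁] at sc₁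
  rw [angle_comm z₂ 0 1, angle_comm 1 z₂ 0, qa₂, qc₂, t₂] at sc₂
  rw [angle_comm z₃ z₁ 0, qb₁, qd₁, t₁₃] at sd₁
  rw [angle_comm z₃ z₂ 0, qb₂, qd₂, t₂₃] at sd₂
  -- the other points lie on one side of the line through `0` and `1`, and likewise for `z₃`
  have i₁ : 0 < (z₁ / 1).im := im_div_pos m0 n₁ arg1.ge (by rwa [arg1]) (by linarith)
  have i₂ : 0 < (z₂ / 1).im := im_div_pos m0 n₂ arg1.ge (by rw [arg1]; linarith) (by linarith)
  have i₃ : 0 < (z₃ / 1).im := im_div_pos m0 n₃ arg1.ge (by rw [arg1]; linarith) h3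
  have j₀ : (1 / z₃).im < 0 := im_div_neg m0 n₃ arg1.ge (by rw [arg1]; linarith) h3
  have j₁ : (z₁ / z₃).im < 0 := im_div_neg n₁ n₃ h01.le (by linarith) h3
  have j₂ : (z₂ / z₃).im < 0 := im_div_neg n₂ n₃ (by linarith) h23 h3
  have ne : ∀ {x p q : ℂ} {a b : ℕ}, x ∈ S → p ∈ S → q ∈ S → x ≠ 0 → x ≠ p → p ≠ q → x ≠ q →
      0 < (p / x).im * (q / x).im → ∠ 0 x p = a * α → ∠ 0 x q = b * α → a ≠ b := by
    intro x p q a b hx hp hq x0 hxp hpq hxq him ha hb hab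
    exact hcol x hx p hp q hq hxp hpq hxq
      (collinear_of_angle_eq_of_same_side x0 him (by rw [ha, hb, hab]))
  have hα0 : α ≠ 0 := h01.ne'
  have cast : ∀ {k l : ℕ}, (k : ℝ) * α = l * α → k = l := fun h => by
    exact_mod_cast mul_right_cancel₀ hα0 h
  -- the triangle `0, 1, z₃` shows that `π` is an integer multiple of `α`
  have hm : π = ((3 + a₃ + b₀ : ℕ) : ℝ) * α := by rw [← s]; push_cast; ring
  have opp₁ : f₁ = c₁ + d₁ ∨ f₁ + (c₁ + d₁) = 2 * (3 + a₃ + b₀) := by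
    refine (angle_eq_add_of_opposite_sides n₁ (mul_neg_of_neg_of_pos
      (im_div_neg m0 n₁ arg1.ge (by rwa [arg1]) (by linarith))
      (im_div_pos n₁ n₃ h01.le (by linarith) h3))).imp (fun h => cast ?_) (fun h => cast ?_) <;>
    rw [qf₁, qc₁, qd₁] at h
    · push_cast; linarith
    · rw [hm] at h; push_cast at h ⊢; linarith
  have opp₂ : f₂ = c₂ + d₂ ∨ f₂ + (c₂ + d₂) = 2 * (3 + a₃ + b₀) := by
    refine (angle_eq_add_of_opposite_sides n₂ (mul_neg_of_neg_of_pos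
      (im_div_neg m0 n₂ arg1.ge (by rw [arg1]; linarith) (by linarith))
      (im_div_pos n₂ n₃ (by linarith) h23 h3))).imp (fun h => cast ?_) (fun h => cast ?_) <;>
    rw [qf₂, qc₂, qd₂] at h
    · push_cast; linarith
    · rw [hm] at h; push_cast at h ⊢; linarith
  obtain ⟨hm5, rfl, rfl, rfl⟩ := multiples_eq ha₁ ha₂ ha₃ hb₀ hb₁ hb₂ hc₁ hc₂ hd₁ hd₂ hf₁ hf₂
    (ne hz₀ hz₁ hz₂ m0 e₁ e₁₂ e₂ (mul_pos i₁ i₂) qa₁ qa₂)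
    (ne hz₀ hz₁ hz₃ m0 e₁ e₁₃ e₃ (mul_pos i₁ i₃) qa₁ qa₃)
    (ne hz₀ hz₂ hz₃ m0 e₂ e₂₃ e₃ (mul_pos i₂ i₃) qa₂ qa₃)
    (ne hz₃ hz₀ hz₁ n₃ e₃.symm e₁ e₁₃.symm (mul_pos_of_neg_of_neg j₀ j₁) qb₀ qb₁)
    (ne hz₃ hz₀ hz₂ n₃ e₃.symm e₂ e₂₃.symm (mul_pos_of_neg_of_neg j₀ j₂) qb₀ qb₂)
    (ne hz₃ hz₁ hz₂ n₃ e₁₃.symm e₁₂ e₂₃.symm (mul_pos_of_neg_of_neg j₁ j₂) qb₁ qb₂)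
    rfl (cast (by push_cast at hm ⊢; linarith)) (cast (by push_cast at hm ⊢; linarith))
    (cast (by push_cast at hm ⊢; linarith)) (cast (by push_cast at hm ⊢; linarith)) opp₁ opp₂
  rw [hm5] at hm
  push_cast at hm qa₁ qa₂ qa₃
  have hα5 : α = π / 5 := by linarith
  rw [qa₁, qa₂, qa₃, r₂, r₃, hα5]
  refine ⟨⟨rfl, rfl⟩, ⟨rfl, rfl⟩, rfl, one_mul _⟩

/-- The point where the line through `0` in direction `w ^ k` meets the line through `1` in
direction `w ^ (k + 1)`. The second coordinate `s` is found by comparing the equation with its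
complex conjugate. -/
theorem mul_eq_of_ray_of_line {w : ℂ} (hw : ‖w‖ = 1) (k : ℕ) {r s : ℝ}
    (h : r * w ^ k = 1 + s * w ^ (k + 1)) (z : ℂ) (hz : z = r * w ^ k) :
    (w ^ 2 - 1) * z = w ^ (2 * k + 2) - 1 := by
  have hw0 : w ≠ 0 := by rintro rfl; simp at hw
  have hc : (starRingEnd ℂ) w = w⁻¹ := by
    rw [Complex.inv_def, Complex.normSq_eq_norm_sq, hw]; simp
  have h' := congrArg (starRingEnd ℂ) h
  simp only [map_mul, map_add, map_pow, hc, Complex.conj_ofReal, map_one] at h'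
  have h'' : r * w = w ^ (k + 1) + s := by
    have : r * w = w ^ (k + 1) * (r * w⁻¹ ^ k) := by
      rw [inv_pow]; field_simp; ring
    rw [this, h', inv_pow]; field_simp
  rw [hz]
  have e1 : w ^ (2 * k + 2) = w ^ (k + 1) * w ^ (k + 1) := by ring
  have e2 : w ^ (k + 1) = w ^ k * w := pow_succ _ _
  rw [e1]
  rw [e2] at h h'' ⊢
  linear_combination w ^ k * w * h'' - h

/-- The rays from `0` and `1` at angles `k π / 5` and `(4 - k) π / 5` to the segment meet in
`1 + w ^ 2 + ⋯ + w ^ (2 * k)`, a vertex of the regular pentagon with that segment as a side. -/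
theorem eq_of_arg_of_angle {z : ℂ} {k : ℕ} (hk : k ≤ 3) (hk0 : 0 < k)
    (harg : z.arg = k * (π / 5)) (ha : ∠ 0 1 z = (4 - k) * (π / 5)) (w : ℂ)
    (hw : w = Complex.exp (π / 5 * Complex.I)) : (w ^ 2 - 1) * z = w ^ (2 * k + 2) - 1 := by
  have hkr : (k : ℝ) ≤ 3 := by exact_mod_cast hk
  have hkr0 : (0 : ℝ) < k := by exact_mod_cast hk0
  have hπ := Real.pi_pos
  have hn : ‖w‖ = 1 := by
    rw [hw]; exact_mod_cast Complex.norm_exp_ofReal_mul_I (π / 5)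
  have hz := Complex.norm_mul_exp_arg_mul_I z
  have hwk : ∀ j : ℕ, w ^ j = Complex.exp (j * (π / 5) * Complex.I) := fun j => by
    rw [hw, ← Complex.exp_nat_mul]; ring_nf
  rw [harg] at hz
  push_cast at hz
  rw [← hwk] at hz
  have hz1 : z ≠ 1 := by
    rintro rfl
    rw [Complex.arg_one] at harg
    nlinarith
  have him : 0 < z.im := by
    refine lt_of_le_of_ne (Complex.arg_nonneg_iff.1 (by rw [harg]; positivity)) fun h2 => ?_
    rcases le_or_gt 0 z.re with h5 | h5
    · have := Complex.arg_eq_zero_iff.2 ⟨h5, h2.symm⟩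
      nlinarith
    · have := Complex.arg_eq_pi_iff.2 ⟨h5, h2.symm⟩
      nlinarith
  have hz1' := sub_ne_zero.2 hz1
  rw [angle_comm, angle_eq_abs_arg_div hz1 zero_ne_one] at ha
  have e : (z - 1) / (0 - 1) = 1 - z := by ring
  rw [e, abs_of_neg (Complex.arg_neg_iff.2 (by simpa))] at ha
  have h1 := Complex.norm_mul_exp_arg_mul_I (1 - z)
  have e2 : (1 - z).arg = (k + 1) * (π / 5) - π := by linarith
  rw [e2] at h1
  push_cast at h1
  rw [sub_mul, Complex.exp_sub, Complex.exp_pi_mul_I] at h1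
  have := hwk (k + 1)
  push_cast at this
  rw [← this] at h1
  refine mul_eq_of_ray_of_line hn k (r := ‖z‖) (s := ‖1 - z‖) ?_ z hz.symm
  rw [hz]
  linear_combination h1

/-! ### Five points in general position: the regular pentagon -/

/-- From a suitable point of a finite set without collinear triples all the others are seen, in
distinct directions, in a half-plane. -/
theorem exists_strictMono_arg {n : ℕ} {F : Finset ℂ} (hF : F.card = n + 1)
    (hcol : ∀ a ∈ F, ∀ b ∈ F, ∀ c ∈ F, a ≠ b → b ≠ c → a ≠ c → ¬ Collinear ℝ {a, b, c}) :
    ∃ v ∈ F, ∃ p : Fin n → ℂ, (∀ i, p i ∈ F ∧ p i ≠ v) ∧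
      StrictMono (fun i => (p i - v).arg) ∧ ∀ i, 0 ≤ (p i - v).arg ∧ (p i - v).arg < π := by
  classical
  -- the lowest point, and the leftmost one among those
  obtain ⟨v, hv, hmin⟩ := F.exists_min_image (fun z => toLex (z.im, z.re))
    (Finset.card_pos.1 (by omega))
  have hangle : ∀ z ∈ F, z ≠ v → 0 ≤ (z - v).arg ∧ (z - v).arg < π := by
    intro z hz hzv
    have h := hmin z hz
    rw [Prod.Lex.toLex_le_toLex] at h
    constructor
    · rw [Complex.arg_nonneg_iff, Complex.sub_im]
      rcases h with h | h
      · exact sub_nonneg.2 h.le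
      · exact sub_nonneg.2 h.1.le
    · refine lt_of_le_of_ne (Complex.arg_le_pi _) fun e => ?_
      obtain ⟨h1, h2⟩ := Complex.arg_eq_pi_iff.1 e
      rw [Complex.sub_re] at h1
      rw [Complex.sub_im] at h2
      rcases h with h | h <;> simp only at h
      · linarith
      · linarith [h.2]
  have hinj : Set.InjOn (fun z => (z - v).arg) (F.erase v : Finset ℂ) := by
    intro x hx y hy hxy
    simp only [Finset.coe_erase, Set.mem_sdiff, Finset.mem_coe, Set.mem_singleton_iff] at hx hy hxy
    by_contra hne
    refine hcol x hx.1 v hv y hy.1 hx.2 (Ne.symm hy.2) hne (collinear_of_angle_eq_zero ?_)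
    rw [angle_eq_abs_arg_div hx.2 hy.2, arg_div_eq_sub (sub_ne_zero.2 hx.2) (sub_ne_zero.2 hy.2),
      hxy, sub_self, abs_zero]
    rw [hxy, sub_self]
    exact ⟨neg_lt_zero.2 Real.pi_pos, Real.pi_pos.le⟩
  have hcard : ((F.erase v).image fun z => (z - v).arg).card = n := by
    rw [Finset.card_image_of_injOn hinj, Finset.card_erase_of_mem hv, hF]; rfl
  have hp : ∀ i : Fin n, ∃ z ∈ F.erase v, (z - v).arg = Finset.orderEmbOfFin _ hcard i := fun i =>
    Finset.mem_image.1 (Finset.orderEmbOfFin_mem _ hcard i)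
  choose p hpF hp using hp
  refine ⟨v, hv, p, fun i => ⟨Finset.mem_of_mem_erase (hpF i), Finset.ne_of_mem_erase (hpF i)⟩,
    fun i j hij => ?_, fun i => hangle _ (Finset.mem_of_mem_erase (hpF i))
      (Finset.ne_of_mem_erase (hpF i))⟩
  simp only [hp]
  exact (Finset.orderEmbOfFin _ hcard).strictMono hij

/-- A set without collinear triples in which only three angles occur has at most five points. -/
theorem encard_le_five {T : Set ℝ} (hT : T.encard ≤ 3) {S : Set ℂ} (hS : AnglesMem T S)
    (hcol : ∀ a ∈ S, ∀ b ∈ S, ∀ c ∈ S, a ≠ b → b ≠ c → a ≠ c → ¬ Collinear ℝ {a, b, c}) :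
    S.encard ≤ 5 := by
  by_contra! h
  obtain ⟨F, hFS, hF⟩ := Set.exists_subset_encard_eq (Order.add_one_le_of_lt h)
  norm_num at hF
  have hfin : F.Finite := Set.finite_of_encard_eq_coe (k := 6) hF
  lift F to Finset ℂ using hfin
  rw [Set.encard_coe_eq_coe_finsetCard] at hF
  have hF' : F.card = 5 + 1 := by exact_mod_cast hF
  obtain ⟨v, hv, p, hpF, hmono, harg⟩ := exists_strictMono_arg hF' fun a ha b hb c hc =>
    hcol a (hFS ha) b (hFS hb) c (hFS hc)
  -- the angles between the first ray and the four others are distinct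
  have key : ∀ i : Fin 5, 0 < i → (p i - v).arg - (p 0 - v).arg ∈ T := by
    intro i hi
    have h0i := hmono hi
    simp only at h0i
    have hne : p 0 ≠ p i := by
      intro e
      rw [e] at h0i
      exact h0i.false
    have hmem := hS.angle_mem (hFS (hpF 0).1) (hFS hv) (hFS (hpF i).1)
      (hcol _ (hFS (hpF 0).1) _ (hFS hv) _ (hFS (hpF i).1) (hpF 0).2 (hpF i).2.symm hne)
    have e := angle_zero_eq_sub (sub_ne_zero.2 (hpF 0).2) (sub_ne_zero.2 (hpF i).2)
      (harg 0).1 h0i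
    rw [← e]
    have := angle_sub_const (p 0) v (p i) v
    rw [sub_self] at this
    rwa [this]
  have h12 := hmono (show (1 : Fin 5) < 2 by decide)
  have h23 := hmono (show (2 : Fin 5) < 3 by decide)
  have h34 := hmono (show (3 : Fin 5) < 4 by decide)
  simp only at h12 h23 h34
  rcases exists_eq_of_encard_le_three hT (key 1 (by decide)) (key 2 (by decide))
    (key 3 (by decide)) (key 4 (by decide)) with e | e | e | e | e | e <;> linarith

/-- The similarity `z ↦ b + u * z` of the complex plane. -/
noncomputable def complexSimilarity (b u : ℂ) (hu : u ≠ 0) : ℂ ≃ᵈ ℂ :=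
  (DilationEquiv.mulLeft u hu).trans (IsometryEquiv.addLeft b).toDilationEquiv

theorem complexSimilarity_apply (b u : ℂ) (hu : u ≠ 0) (z : ℂ) :
    complexSimilarity b u hu z = b + u * z := rfl

/-- Five points in general position with at most three angles contain, and hence are, the vertices
of a regular pentagon. -/
theorem exists_pentagon_subset {T : Set ℝ} (hT : T.encard ≤ 3) {S : Set ℂ} (hS : AnglesMem T S)
    (hcol : ∀ a ∈ S, ∀ b ∈ S, ∀ c ∈ S, a ≠ b → b ≠ c → a ≠ c → ¬ Collinear ℝ {a, b, c})
    (h5 : S.encard = 5) :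
    ∃ b u : ℂ, u ≠ 0 ∧ ∀ j : Fin 5, b + u * Complex.exp (2 * (π / 5) * Complex.I) ^ (j : ℕ) ∈ S := by
  have hfin : S.Finite := Set.finite_of_encard_eq_coe (k := 5) h5
  lift S to Finset ℂ using hfin
  rw [Set.encard_coe_eq_coe_finsetCard] at h5
  have hF : S.card = 4 + 1 := by exact_mod_cast h5
  obtain ⟨v, hv, p, hpF, hmono, harg⟩ := exists_strictMono_arg hF hcol
  have hu : p 0 - v ≠ 0 := sub_ne_zero.2 (hpF 0).2
  -- move `v` to `0` and `p 0` to `1`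
  set f := (complexSimilarity v (p 0 - v) hu).symm with hf
  have hfz : ∀ z, f z = (z - v) / (p 0 - v) := by
    intro z
    rw [hf, DilationEquiv.symm_apply_eq, complexSimilarity_apply]
    field_simp
    ring
  have hf0 : f v = 0 := by simp [hfz]
  have hf1 : f (p 0) = 1 := by rw [hfz, div_self hu]
  have hargf : ∀ i, (f (p i)).arg = (p i - v).arg - (p 0 - v).arg := by
    intro i
    rw [hfz, arg_div_eq_sub (sub_ne_zero.2 (hpF i).2) hu]
    have := harg i
    have := harg 0
    constructor <;> linarith
  have hfn : ∀ i, f (p i) ≠ 0 := fun i => hf0 ▸ f.injective.ne (hpF i).2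
  have h01 := hmono (show (0 : Fin 4) < 1 by decide)
  have h12 := hmono (show (1 : Fin 4) < 2 by decide)
  have h23 := hmono (show (2 : Fin 4) < 3 by decide)
  simp only at h01 h12 h23
  obtain ⟨⟨a1, b1⟩, ⟨a2, b2⟩, a3, b3⟩ := angles_determined hT (hS.image f) (by
      rintro _ ⟨a, ha, rfl⟩ _ ⟨b, hb, rfl⟩ _ ⟨c, hc, rfl⟩ hab hbc hac
      rw [collinear_map_dilationEquiv_iff]
      exact hcol a ha b hb c hc (fun e => hab (e ▸ rfl)) (fun e => hbc (e ▸ rfl))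
        (fun e => hac (e ▸ rfl)))
    ⟨v, hv, hf0⟩ ⟨p 0, (hpF 0).1, hf1⟩ ⟨p 1, (hpF 1).1, rfl⟩ ⟨p 2, (hpF 2).1, rfl⟩
    ⟨p 3, (hpF 3).1, rfl⟩ (hfn 1) (hfn 2) (hfn 3)
    (by rw [hargf]; linarith) (by rw [hargf, hargf]; linarith) (by rw [hargf, hargf]; linarith)
    (by rw [hargf]; linarith [(harg 3).2, (harg 0).1])
  set w := Complex.exp (π / 5 * Complex.I) with hw
  have q1 := eq_of_arg_of_angle (k := 1) (by norm_num) (by norm_num) (by rw [a1]; norm_num)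
    (by rw [b1]; norm_num) w hw
  have q2 := eq_of_arg_of_angle (k := 2) (by norm_num) (by norm_num) (by rw [a2]; norm_num)
    (by rw [b2]; norm_num) w hw
  have q3 := eq_of_arg_of_angle (k := 3) (by norm_num) (by norm_num) (by rw [a3]; norm_num)
    (by rw [b3]; norm_num) w hw
  have hζ : Complex.exp (2 * (π / 5) * Complex.I) = w ^ 2 := by
    rw [hw, ← Complex.exp_nat_mul]; push_cast; ring_nf
  have hw2 : w ^ 2 - 1 ≠ 0 := by
    intro h
    have h1 : (w ^ 2).im = 0 := by rw [sub_eq_zero.1 h]; simp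
    have h2 : (Complex.exp (((2 * (π / 5) : ℝ) : ℂ) * Complex.I)).im = 0 := by
      rw [← h1, ← hζ]; push_cast; rfl
    rw [Complex.exp_ofReal_mul_I_im] at h2
    exact (Real.sin_pos_of_pos_of_lt_pi (by positivity) (by linarith [Real.pi_pos])).ne' h2
  rw [hfz] at q1 q2 q3
  have hu' : (p 0 - v) / (w ^ 2 - 1) ≠ 0 := div_ne_zero hu hw2
  -- `w ^ 2` is a primitive fifth root of unity, and `v` and `p 0` become `1` and `w ^ 2`
  refine ⟨v - (p 0 - v) / (w ^ 2 - 1), (p 0 - v) / (w ^ 2 - 1), hu', fun j => ?_⟩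
  rw [hζ]
  have fin : ∀ (i : Fin 4) (k : ℕ), (w ^ 2 - 1) * ((p i - v) / (p 0 - v)) = w ^ (2 * k + 2) - 1 →
      v - (p 0 - v) / (w ^ 2 - 1) + (p 0 - v) / (w ^ 2 - 1) * (w ^ 2) ^ (k + 1) ∈ (S : Set ℂ) := by
    intro i k h
    refine Set.mem_of_eq_of_mem ?_ (hpF i).1
    have e : (w ^ 2) ^ (k + 1) = w ^ (2 * k + 2) := by rw [← pow_mul]; ring_nf
    rw [e, eq_add_of_sub_eq h.symm]
    field_simp
    ring
  fin_cases j
  · refine Set.mem_of_eq_of_mem ?_ hv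
    simp
  · exact fin 0 0 (by rw [div_self hu]; ring)
  · exact fin 1 1 q1
  · exact fin 2 2 q2
  · exact fin 3 3 q3

/-! ### The two extremal configurations -/

/-- The identification of the Euclidean plane with `ℂ`. -/
noncomputable def planeToComplex : Plane ≃ᵈ ℂ :=
  Complex.orthonormalBasisOneI.repr.symm.toIsometryEquiv.toDilationEquiv

theorem planeToComplex_apply (x y : ℝ) : planeToComplex !₂[x, y] = x + y * Complex.I := by
  change Complex.orthonormalBasisOneI.repr.symm !₂[x, y] = _
  simp

theorem encard_triple_le {α : Type*} (a b c : α) : ({a, b, c} : Set α).encard ≤ 3 := by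
  refine (Set.encard_insert_le _ _).trans ?_
  refine (add_le_add_left (Set.encard_insert_le _ _) 1).trans ?_
  rw [Set.encard_singleton]
  norm_num

/-- The angle between real multiples of two unit vectors depends on the signs of the factors. -/
theorem angle_smul_exp_smul_exp {x y z : ℝ} (hxz : x < z) (hπ : z < x + π) (r s : ℝ)
    (hr : r ≠ 0) (hs : s ≠ 0) :
    InnerProductGeometry.angle (r • (Complex.I * Complex.exp (((x + y : ℝ) : ℂ) * Complex.I)))
      (s • (Complex.I * Complex.exp (((z + y : ℝ) : ℂ) * Complex.I))) =
      if 0 < r * s then z - x else π - (z - x) := by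
  have base : InnerProductGeometry.angle (Complex.I * Complex.exp (((x + y : ℝ) : ℂ) * Complex.I))
      (Complex.I * Complex.exp (((z + y : ℝ) : ℂ) * Complex.I)) = z - x := by
    rw [Complex.angle_mul_left Complex.I_ne_zero, Complex.angle_exp_exp,
      (toIocMod_eq_self Real.two_pi_pos).2 ⟨by linarith, by linarith [Real.pi_pos]⟩,
      abs_of_neg (by linarith)]
    ring
  split_ifs with h
  · rcases mul_pos_iff.1 h with ⟨h1, h2⟩ | ⟨h1, h2⟩
    · rw [InnerProductGeometry.angle_smul_left_of_pos _ _ h1,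
        InnerProductGeometry.angle_smul_right_of_pos _ _ h2, base]
    · rw [InnerProductGeometry.angle_smul_left_of_neg _ _ h1,
        InnerProductGeometry.angle_smul_right_of_neg _ _ h2, InnerProductGeometry.angle_neg_neg,
        base]
  · rcases hr.lt_or_gt with h1 | h1 <;> rcases hs.lt_or_gt with h2 | h2
    · exact absurd (mul_pos_of_neg_of_neg h1 h2) h
    · rw [InnerProductGeometry.angle_smul_left_of_neg _ _ h1,
        InnerProductGeometry.angle_smul_right_of_pos _ _ h2, InnerProductGeometry.angle_neg_left,
        base]
    · rw [InnerProductGeometry.angle_smul_left_of_pos _ _ h1,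
        InnerProductGeometry.angle_smul_right_of_neg _ _ h2, InnerProductGeometry.angle_neg_right,
        base]
    · exact absurd (mul_pos h1 h2) h

/-- A chord of the unit circle is perpendicular to the direction of the midpoint of its arc. -/
theorem exp_sub_exp_eq (x y : ℝ) :
    Complex.exp (((2 * x : ℝ) : ℂ) * Complex.I) - Complex.exp (((2 * y : ℝ) : ℂ) * Complex.I) =
      (2 * Real.sin (x - y)) • (Complex.I * Complex.exp (((x + y : ℝ) : ℂ) * Complex.I)) := by
  have h := Complex.two_sin ((x : ℂ) - y)
  rw [Complex.real_smul]
  push_cast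
  rw [h]
  have e1 : Complex.exp (2 * (x : ℂ) * Complex.I) =
      Complex.exp (((x : ℂ) - y) * Complex.I) * Complex.exp ((x + y) * Complex.I) := by
    rw [← Complex.exp_add]; ring_nf
  have e2 : Complex.exp (2 * (y : ℂ) * Complex.I) =
      Complex.exp (-((x : ℂ) - y) * Complex.I) * Complex.exp ((x + y) * Complex.I) := by
    rw [← Complex.exp_add]; ring_nf
  rw [e1, e2]
  linear_combination (Complex.exp (((x : ℂ) - y) * Complex.I) -
    Complex.exp (-((x : ℂ) - y) * Complex.I)) * Complex.exp ((x + y) * Complex.I) * Complex.I_mul_I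

/-- The inscribed angle theorem on the unit circle: the angle is `z - x`, half the arc from
`exp (2 x i)` to `exp (2 z i)`, or half the complementary arc if the vertex lies on the former. -/
theorem angle_exp_exp_exp {x y z : ℝ} (hxz : x < z) (hxπ : z < x + π) (hxy : x ≠ y) (hyz : y ≠ z)
    (h1 : |x - y| < π) (h2 : |z - y| < π) :
    ∠ (Complex.exp (((2 * x : ℝ) : ℂ) * Complex.I)) (Complex.exp (((2 * y : ℝ) : ℂ) * Complex.I))
      (Complex.exp (((2 * z : ℝ) : ℂ) * Complex.I)) =
      if x < y ∧ y < z then π - (z - x) else z - x := by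
  have sgn : ∀ {t : ℝ}, t ≠ 0 → |t| < π → (0 < t ∧ 0 < Real.sin t) ∨ (t < 0 ∧ Real.sin t < 0) :=
    fun h0 ht => h0.lt_or_gt.symm.imp
      (fun h => ⟨h, Real.sin_pos_of_pos_of_lt_pi h (abs_lt.1 ht).2⟩)
      (fun h => ⟨h, Real.sin_neg_of_neg_of_neg_pi_lt h (abs_lt.1 ht).1⟩)
  unfold EuclideanGeometry.angle
  rw [vsub_eq_sub, vsub_eq_sub, exp_sub_exp_eq, exp_sub_exp_eq]
  rcases sgn (sub_ne_zero.2 hxy) h1 with ⟨a, s⟩ | ⟨a, s⟩ <;>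
    rcases sgn (sub_ne_zero.2 hyz.symm) h2 with ⟨b, t⟩ | ⟨b, t⟩ <;>
    rw [angle_smul_exp_smul_exp hxz hxπ _ _
      (mul_ne_zero two_ne_zero (by first | exact s.ne' | exact s.ne))
      (mul_ne_zero two_ne_zero (by first | exact t.ne' | exact t.ne))]
  · rw [if_pos (by positivity), if_neg (fun h => by linarith [h.1])]
  · linarith
  · rw [if_neg (by nlinarith), if_pos ⟨by linarith, by linarith⟩]
  · rw [if_pos (by nlinarith), if_neg (fun h => by linarith [h.2])]

theorem planeToComplex_pentagon (j : Fin 5) :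
    planeToComplex !₂[Real.cos (2 * π * (j : ℝ) / 5), Real.sin (2 * π * (j : ℝ) / 5)] =
      Complex.exp (((2 * (j * (π / 5)) : ℝ) : ℂ) * Complex.I) := by
  rw [planeToComplex_apply, Complex.exp_mul_I, ← Complex.ofReal_cos, ← Complex.ofReal_sin]
  ring_nf

theorem pentagon_angle_of_lt {i j k : Fin 5} (hik : i < k) (hij : i ≠ j) (hjk : j ≠ k) :
    ∠ (Complex.exp (((2 * (i * (π / 5)) : ℝ) : ℂ) * Complex.I))
      (Complex.exp (((2 * (j * (π / 5)) : ℝ) : ℂ) * Complex.I))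
      (Complex.exp (((2 * (k * (π / 5)) : ℝ) : ℂ) * Complex.I)) ∈
      ({π / 5, 2 * (π / 5), 3 * (π / 5)} : Set ℝ) := by
  have hα : 0 < π / 5 := by positivity
  have bd : ∀ a b : Fin 5, |(a : ℝ) * (π / 5) - b * (π / 5)| < π := by
    intro a b
    have ha : ((a : ℕ) : ℝ) ≤ 4 := by exact_mod_cast Nat.lt_succ_iff.1 a.2
    have hb : ((b : ℕ) : ℝ) ≤ 4 := by exact_mod_cast Nat.lt_succ_iff.1 b.2
    have ha0 : (0 : ℝ) ≤ ((a : ℕ) : ℝ) := Nat.cast_nonneg _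
    have hb0 : (0 : ℝ) ≤ ((b : ℕ) : ℝ) := Nat.cast_nonneg _
    rw [abs_lt]
    constructor <;> nlinarith
  have lt : ∀ {a b : Fin 5}, (a : ℝ) * (π / 5) < b * (π / 5) ↔ a < b := by
    intro a b
    rw [mul_lt_mul_iff_left₀ hα, Nat.cast_lt, Fin.lt_def]
  have ne : ∀ {a b : Fin 5}, a ≠ b → (a : ℝ) * (π / 5) ≠ b * (π / 5) := by
    intro a b h e
    exact h (Fin.ext (by exact_mod_cast mul_right_cancel₀ hα.ne' e))
  rw [angle_exp_exp_exp (lt.2 hik) (by linarith [abs_lt.1 (bd k i)]) (ne hij) (ne hjk) (bd _ _)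
    (bd _ _)]
  simp only [lt]
  have hn : ∀ n : ℕ, n ∈ Set.Icc 1 3 → (n : ℝ) * (π / 5) ∈
      ({π / 5, 2 * (π / 5), 3 * (π / 5)} : Set ℝ) := by
    rintro n ⟨h1, h3⟩
    interval_cases n <;> simp
  obtain ⟨i, hi⟩ := i
  obtain ⟨j, hj⟩ := j
  obtain ⟨k, hk⟩ := k
  simp only [Fin.mk_lt_mk, ne_eq, Fin.mk.injEq] at *
  split_ifs with h
  · convert hn (5 - (k - i)) ⟨by omega, by omega⟩ using 1
    rw [Nat.cast_sub (by omega), Nat.cast_sub hik.le]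
    push_cast
    ring
  · convert hn (k - i) ⟨by omega, by omega⟩ using 1
    rw [Nat.cast_sub hik.le]
    ring

theorem anglesMem_pentagon :
    AnglesMem {π / 5, 2 * (π / 5), 3 * (π / 5)} regularPentagon := by
  rintro _ ⟨i, rfl⟩ _ ⟨j, rfl⟩ _ ⟨k, rfl⟩ hij hjk hik -
  have hij : i ≠ j := fun e => hij (e ▸ rfl)
  have hjk : j ≠ k := fun e => hjk (e ▸ rfl)
  have hik : i ≠ k := fun e => hik (e ▸ rfl)
  rw [← angle_map_dilationEquiv planeToComplex, planeToComplex_pentagon, planeToComplex_pentagon,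
    planeToComplex_pentagon]
  rcases hik.lt_or_gt with h | h
  · exact pentagon_angle_of_lt h hij hjk
  · rw [angle_comm]
    exact pentagon_angle_of_lt h hjk.symm hij.symm

theorem pentagon_injective : Function.Injective fun j : Fin 5 =>
    (!₂[Real.cos (2 * π * (j : ℝ) / 5), Real.sin (2 * π * (j : ℝ) / 5)] : Plane) := by
  intro i j h
  have h1 := congrArg planeToComplex h
  simp only [planeToComplex_pentagon] at h1
  have hα : 0 < π / 5 := by positivity
  have ha : ∀ a : Fin 5, ((a : ℕ) : ℝ) ≤ 4 := fun a => by exact_mod_cast Nat.lt_succ_iff.1 a.2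
  have ha0 : ∀ a : Fin 5, (0 : ℝ) ≤ ((a : ℕ) : ℝ) := fun a => Nat.cast_nonneg _
  have h2 := sub_eq_zero.2 h1
  rw [exp_sub_exp_eq, smul_eq_zero,
    or_iff_left (mul_ne_zero Complex.I_ne_zero (Complex.exp_ne_zero _)),
    mul_eq_zero, or_iff_right two_ne_zero,
    Real.sin_eq_zero_iff_of_lt_of_lt (by nlinarith [ha i, ha j, ha0 i, ha0 j])
      (by nlinarith [ha i, ha j, ha0 i, ha0 j])] at h2
  exact Fin.ext (by exact_mod_cast mul_right_cancel₀ hα.ne' (sub_eq_zero.1 h2))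

theorem encard_pentagon : regularPentagon.encard = 5 := by
  rw [regularPentagon, ← Set.image_univ, pentagon_injective.encard_image, Set.encard_univ]
  simp

theorem exists_image_pentagon_subset {S : Set ℂ} {b u : ℂ} (hu : u ≠ 0)
    (h : ∀ j : Fin 5, b + u * Complex.exp (2 * (π / 5) * Complex.I) ^ (j : ℕ) ∈ S) :
    ∃ f : Plane ≃ᵈ ℂ, f '' regularPentagon ⊆ S := by
  refine ⟨planeToComplex.trans (complexSimilarity b u hu), ?_⟩
  rintro _ ⟨_, ⟨j, rfl⟩, rfl⟩
  refine Set.mem_of_eq_of_mem ?_ (h j)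
  change complexSimilarity b u hu (planeToComplex _) = _
  rw [planeToComplex_pentagon, complexSimilarity_apply,
    ← Complex.exp_nat_mul]
  push_cast
  ring_nf

/-- Integer coordinates of the vertices and the centre of the square. -/
def squarePoint : Fin 5 → ℤ × ℤ := ![(1, 1), (-1, 1), (-1, -1), (1, -1), (0, 0)]

theorem squareWithCentre_eq_range : squareWithCentre =
    Set.range fun i => (!₂[((squarePoint i).1 : ℝ), ((squarePoint i).2 : ℝ)] : Plane) := by
  ext p
  simp only [squareWithCentre, Set.mem_insert_iff, Set.mem_singleton_iff, Set.mem_range,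
    Fin.exists_fin_succ, squarePoint, eq_comm (a := p)]
  simp

/-- The hypothesis places `z` on the real or the imaginary axis, or on one of the two diagonals of
the right half-plane. -/
theorem abs_arg_mem_of_re_im {z : ℂ} (hz : z ≠ 0) (h : z.im = 0 ∨ z.re = 0 ∨ z.re = |z.im|)
    (hπ : |z.arg| ≠ π) : |z.arg| ∈ ({0, π / 4, π / 2} : Set ℝ) := by
  have hn : ‖z‖ ≠ 0 := norm_ne_zero_iff.2 hz
  have h1 : ‖z‖ * Real.cos |z.arg| = z.re := by rw [Real.cos_abs, Complex.norm_mul_cos_arg]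
  have hs := Real.sin_nonneg_of_nonneg_of_le_pi (abs_nonneg z.arg) (Complex.abs_arg_le_pi z)
  have h2 : ‖z‖ * Real.sin |z.arg| = |z.im| := by
    rw [← abs_of_nonneg hs, ← Complex.norm_mul_sin_arg z, abs_mul, abs_norm]
    rcases abs_choice z.arg with e | e <;> simp [e]
  have h0 := abs_nonneg z.arg
  have hle := Complex.abs_arg_le_pi z
  set θ := |z.arg|
  rcases h with h | h | h
  · left
    rw [h, abs_zero, mul_eq_zero, or_iff_right hn] at h2
    by_contra hθ
    exact (Real.sin_pos_of_pos_of_lt_pi (lt_of_le_of_ne h0 (Ne.symm hθ))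
      (lt_of_le_of_ne hle hπ)).ne' h2
  · right; right
    rw [h, mul_eq_zero, or_iff_right hn, ← Real.cos_pi_div_two] at h1
    exact Real.injOn_cos ⟨h0, hle⟩ ⟨by positivity, by linarith [Real.pi_pos]⟩ h1
  · right; left
    rw [← h1, ← h2] at h
    have h3 := mul_left_cancel₀ hn h
    have hθ : θ ≤ π / 2 := by
      by_contra! hlt
      linarith [Real.cos_neg_of_pi_div_two_lt_of_lt hlt (by linarith [Real.pi_pos])]
    rw [← Real.cos_pi_div_two_sub] at h3
    have := Real.injOn_cos ⟨h0, hle⟩ ⟨by linarith, by linarith [Real.pi_pos]⟩ h3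
    linarith

theorem anglesMem_square : AnglesMem {0, π / 4, π / 2} squareWithCentre := by
  rw [squareWithCentre_eq_range]
  rintro _ ⟨i, rfl⟩ _ ⟨j, rfl⟩ _ ⟨k, rfl⟩ hij hjk hik
  have e := angle_map_dilationEquiv planeToComplex
    !₂[((squarePoint i).1 : ℝ), ((squarePoint i).2 : ℝ)]
    !₂[((squarePoint j).1 : ℝ), ((squarePoint j).2 : ℝ)]
    !₂[((squarePoint k).1 : ℝ), ((squarePoint k).2 : ℝ)]
  have hij' := planeToComplex.injective.ne hij
  have hkj' := planeToComplex.injective.ne hjk.symm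
  have hij : i ≠ j := fun e => hij (e ▸ rfl)
  have hjk : j ≠ k := fun e => hjk (e ▸ rfl)
  have hik : i ≠ k := fun e => hik (e ▸ rfl)
  rw [← e]
  rw [angle_eq_abs_arg_div hij' hkj']
  refine abs_arg_mem_of_re_im (div_ne_zero (sub_ne_zero.2 hij') (sub_ne_zero.2 hkj')) ?_
  have hN : 0 < Complex.normSq (
    planeToComplex !₂[((squarePoint k).1 : ℝ), ((squarePoint k).2 : ℝ)] -
    planeToComplex !₂[((squarePoint j).1 : ℝ), ((squarePoint j).2 : ℝ)]) :=
    Complex.normSq_pos.2 (sub_ne_zero.2 hkj')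
  rw [Complex.div_re, Complex.div_im, ← add_div, ← sub_div, abs_div, abs_of_pos hN,
    div_left_inj' hN.ne', div_eq_zero_iff, or_iff_left hN.ne', div_eq_zero_iff, or_iff_left hN.ne']
  simp only [planeToComplex_apply, Complex.sub_re, Complex.add_re, Complex.ofReal_re,
    Complex.re_ofReal_mul, Complex.I_re, mul_zero, add_zero, Complex.sub_im, Complex.add_im,
    Complex.ofReal_im, Complex.im_ofReal_mul, Complex.I_im, mul_one, zero_add]
  -- inner and outer products of the differences of all triples of vertices
  have key : ∀ i j k : Fin 5, i ≠ j → j ≠ k → i ≠ k →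
      let x := (squarePoint i).1 - (squarePoint j).1
      let y := (squarePoint i).2 - (squarePoint j).2
      let s := (squarePoint k).1 - (squarePoint j).1
      let t := (squarePoint k).2 - (squarePoint j).2
      y * s - x * t = 0 ∨ x * s + y * t = 0 ∨ x * s + y * t = |y * s - x * t| := by
    decide
  exact_mod_cast key i j k hij hjk hik

theorem image_square (b u : ℂ) (hu : u ≠ 0) : ∃ f : Plane ≃ᵈ ℂ, f '' squareWithCentre =
    {b + u, b + Complex.I * u, b - u, b - Complex.I * u, b} := by
  have h : 1 + Complex.I ≠ 0 := fun h => by simpa using congrArg Complex.re h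
  have hu' : u / (1 + Complex.I) ≠ 0 := div_ne_zero hu h
  refine ⟨planeToComplex.trans (complexSimilarity b _ hu'), ?_⟩
  simp only [squareWithCentre, Set.image_insert_eq, Set.image_singleton, DilationEquiv.trans_apply,
    Function.comp_apply, planeToComplex_apply, complexSimilarity_apply]
  have e : ∀ z w : ℂ, z = w * (1 + Complex.I) → b + u / (1 + Complex.I) * z = b + w * u := by
    rintro z w rfl
    field_simp
  have hI := Complex.I_mul_I
  rw [e _ 1 (by simp), e _ Complex.I (by push_cast; linear_combination -hI),
    e _ (-1) (by push_cast; ring),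
    e _ (-Complex.I) (by push_cast; linear_combination hI), e _ 0 (by simp)]
  simp [sub_eq_add_neg]

theorem encard_square : squareWithCentre.encard = 5 := by
  have inj : Function.Injective fun i =>
      (!₂[((squarePoint i).1 : ℝ), ((squarePoint i).2 : ℝ)] : Plane) := by
    intro i j h
    have h0 : ((squarePoint i).1 : ℝ) = (squarePoint j).1 := congrArg (fun p : Plane => p 0) h
    have h1 : ((squarePoint i).2 : ℝ) = (squarePoint j).2 := congrArg (fun p : Plane => p 1) h
    have : Function.Injective squarePoint := by decide
    exact this (Prod.ext (by exact_mod_cast h0) (by exact_mod_cast h1))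
  rw [squareWithCentre_eq_range, ← Set.image_univ, inj.encard_image, Set.encard_univ]
  simp

theorem not_collinear_square : ¬ Collinear ℝ squareWithCentre := by
  refine not_collinear_iff_exists_triple.2 ⟨!₂[1, 1], by simp [squareWithCentre], !₂[0, 0],
    by simp [squareWithCentre], !₂[-1, 1], by simp [squareWithCentre], fun h => ?_⟩
  rw [← collinear_map_dilationEquiv_iff planeToComplex, planeToComplex_apply, planeToComplex_apply,
    planeToComplex_apply, collinear_triple_iff] at h
  · obtain ⟨r, hr⟩ := h
    have h1 := congrArg Complex.re hr
    have h2 := congrArg Complex.im hr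
    simp at h1 h2
    linarith
  · intro h
    simpa using congrArg Complex.re h

theorem not_collinear_pentagon : ¬ Collinear ℝ regularPentagon := by
  refine not_collinear_iff_exists_triple.2 ⟨_, ⟨0, rfl⟩, _, ⟨1, rfl⟩, _, ⟨2, rfl⟩, fun h => ?_⟩
  rw [collinear_iff_eq_or_eq_or_angle_eq_zero_or_angle_eq_pi, pentagon_injective.eq_iff,
    pentagon_injective.eq_iff, ← angle_map_dilationEquiv planeToComplex] at h
  simp only [planeToComplex_pentagon] at h
  have hT := pentagon_angle_of_lt (show (0 : Fin 5) < 2 by decide) (show (0 : Fin 5) ≠ 1 by decide)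
    (show (1 : Fin 5) ≠ 2 by decide)
  have hπ := Real.pi_pos
  rcases h with h | h | h | h
  · exact absurd h (by decide)
  · exact absurd h (by decide)
  all_goals
    rw [h] at hT
    rcases hT with e | e | e <;> linarith [Set.mem_singleton_iff.1 e]

theorem angle_square_eq_zero : ∠ (!₂[0, 0] : Plane) !₂[1, 1] !₂[-1, -1] = 0 := by
  have e : (!₂[-1, -1] : Plane) -ᵥ !₂[1, 1] = (2 : ℝ) • ((!₂[0, 0] : Plane) -ᵥ !₂[1, 1]) := by
    ext i
    fin_cases i <;> norm_num
  unfold EuclideanGeometry.angle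
  rw [e, InnerProductGeometry.angle_smul_right_of_pos _ _ two_pos, InnerProductGeometry.angle_self]
  intro h
  simpa using congrArg (fun p : Plane => p 0) h

/-! ### Classification -/

theorem anglesMem_anglesIn (S : Set Plane) : AnglesMem (anglesIn (Set.Ico 0 π) S) S :=
  fun a ha b hb c hc hab hbc hac hπ =>
    ⟨⟨angle_nonneg a b c, lt_of_le_of_ne (angle_le_pi a b c) hπ⟩,
      a, ha, b, hb, c, hc, hab, hbc, hac, rfl⟩

theorem admissible_of_anglesMem {T : Set ℝ} (hT : T.encard ≤ 3) {S : Set Plane}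
    (hS : AnglesMem T S) (hcol : ¬ Collinear ℝ S) : Admissible numAnglesWithZero 3 S := by
  refine ⟨hcol, (Set.encard_le_encard ?_).trans hT⟩
  rintro _ ⟨hI, a, ha, b, hb, c, hc, hab, hbc, hac, rfl⟩
  exact hS a ha b hb c hc hab hbc hac hI.2.ne

theorem admissible_of_similar {S : Set Plane}
    (h : IsSimilarTo S squareWithCentre ∨ IsSimilarTo S regularPentagon) :
    Admissible numAnglesWithZero 3 S ∧ S.encard = 5 := by
  rcases h with ⟨f, rfl⟩ | ⟨f, rfl⟩
  · exact ⟨admissible_of_anglesMem (encard_triple_le _ _ _) (anglesMem_square.image f)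
      (not_collinear_image not_collinear_square f), by
      rw [f.injective.encard_image, encard_square]⟩
  · exact ⟨admissible_of_anglesMem (encard_triple_le _ _ _) (anglesMem_pentagon.image f)
      (not_collinear_image not_collinear_pentagon f), by
      rw [f.injective.encard_image, encard_pentagon]⟩

theorem image_eq_of_subset {X : Set Plane} (hX : X.encard = 5) {S : Set ℂ} {f : Plane ≃ᵈ ℂ}
    (h : f '' X ⊆ S) (hS : S.encard ≤ 5) : f '' X = S := by
  have hfX : (f '' X).encard = 5 := by rw [f.injective.encard_image, hX]
  exact (Set.finite_of_encard_eq_coe (k := 5) hfX).eq_of_subset_of_encard_le h (by rwa [hfX])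

theorem exists_image_eq {T : Set ℝ} (hT : T.encard ≤ 3) {S : Set ℂ} (hS : AnglesMem T S)
    (hcol : ¬ Collinear ℝ S) (h5 : 5 ≤ S.encard) :
    ∃ f : Plane ≃ᵈ ℂ, f '' squareWithCentre = S ∨ f '' regularPentagon = S := by
  by_cases h : ∃ a ∈ S, ∃ b ∈ S, ∃ c ∈ S, Sbtw ℝ a b c
  · obtain ⟨a, ha, b, hb, c, hc, habc⟩ := h
    obtain ⟨b, u, hu, hsub⟩ := exists_subset_square_of_sbtw hT hS hcol ha hb hc habc
    obtain ⟨f, hf⟩ := image_square b u hu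
    rw [← hf] at hsub
    have hfX : (f '' squareWithCentre).encard = 5 := by rw [f.injective.encard_image, encard_square]
    exact ⟨f, Or.inl ((Set.finite_of_encard_eq_coe (k := 5) hfX).eq_of_subset_of_encard_le' hsub
      (by rwa [hfX])).symm⟩
  · push Not at h
    have hgen : ∀ a ∈ S, ∀ b ∈ S, ∀ c ∈ S, a ≠ b → b ≠ c → a ≠ c → ¬ Collinear ℝ {a, b, c} := by
      intro a ha b hb c hc hab hbc hac habc
      rcases habc.wbtw_or_wbtw_or_wbtw with hw | hw | hw
      · exact h a ha b hb c hc ⟨hw, hab.symm, hbc⟩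
      · exact h b hb c hc a ha ⟨hw, hbc.symm, hac.symm⟩
      · exact h c hc a ha b hb ⟨hw, hac, hab⟩
    have hle := encard_le_five hT hS hgen
    obtain ⟨b, u, hu, hsub⟩ := exists_pentagon_subset hT hS hgen (le_antisymm hle h5)
    obtain ⟨f, hf⟩ := exists_image_pentagon_subset hu hsub
    exact ⟨f, Or.inr (image_eq_of_subset encard_pentagon hf hle)⟩

theorem similar_of_admissible {S : Set Plane} (hS : Admissible numAnglesWithZero 3 S)
    (h5 : 5 ≤ S.encard) : IsSimilarTo S squareWithCentre ∨ IsSimilarTo S regularPentagon := by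
  obtain ⟨f, hf⟩ := exists_image_eq hS.2 ((anglesMem_anglesIn S).image planeToComplex)
    (not_collinear_image hS.1 planeToComplex) (by rwa [planeToComplex.injective.encard_image])
  refine hf.imp (fun h => ⟨f.trans planeToComplex.symm, ?_⟩)
    (fun h => ⟨f.trans planeToComplex.symm, ?_⟩) <;>
  rw [show ⇑(f.trans planeToComplex.symm) = planeToComplex.symm ∘ f from rfl, Set.image_comp, h,
    ← Set.image_comp] <;>
  simp

theorem not_similar_pentagon_square : ¬ IsSimilarTo regularPentagon squareWithCentre := by
  rintro ⟨f, hf⟩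
  have mem : ∀ p ∈ squareWithCentre, f p ∈ regularPentagon := fun p hp => hf ▸ ⟨p, hp, rfl⟩
  have e := (angle_map_dilationEquiv f _ _ _).trans angle_square_eq_zero
  have ne : ∀ {x y x' y' : ℝ}, x ≠ x' → f !₂[x, y] ≠ f !₂[x', y'] := fun h h' =>
    h (congrArg (fun p : Plane => p 0) (f.injective h'))
  have h := anglesMem_pentagon _ (mem !₂[0, 0] (by simp [squareWithCentre]))
    _ (mem !₂[1, 1] (by simp [squareWithCentre])) _ (mem !₂[-1, -1] (by simp [squareWithCentre]))
    (ne (by norm_num)) (ne (by norm_num)) (ne (by norm_num)) (by rw [e]; exact Real.pi_pos.ne)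
  rw [e] at h
  have hπ := Real.pi_pos
  rcases h with e | e | e <;> linarith [Set.mem_singleton_iff.1 e]

theorem admissible_of_not_hasCollinearTriple {S : Set Plane} (h : Admissible numAngles 3 S)
    (hS : ¬ HasCollinearTriple S) : Admissible numAnglesWithZero 3 S := by
  refine ⟨h.1, (Set.encard_le_encard ?_).trans h.2⟩
  rintro _ ⟨hI, a, ha, b, hb, c, hc, hab, hbc, hac, rfl⟩
  refine ⟨⟨lt_of_le_of_ne hI.1 fun h0 => hS ?_, hI.2⟩, a, ha, b, hb, c, hc, hab, hbc, hac, rfl⟩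
  exact ⟨a, ha, b, hb, c, hc, hab, hbc, hac, collinear_of_angle_eq_zero h0.symm⟩

theorem mainTheorem6 :
    -- the largest size is 5 when the angle 0 is also counted
    IsMaxSize numAnglesWithZero 3 5 ∧
    -- the optimal sets are exactly the squares with centre and the regular pentagons
    (∀ S : Set Plane, (Admissible numAnglesWithZero 3 S ∧ S.encard = 5) ↔
      (IsSimilarTo S squareWithCentre ∨ IsSimilarTo S regularPentagon)) ∧
    -- the two optimal configurations are different
    ¬ IsSimilarTo regularPentagon squareWithCentre ∧
    -- any other set that is optimal for the usual count (without the angle 0) contains a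
    -- collinear triple and is no longer admissible
    (∀ S : Set Plane, Admissible numAngles 3 S → S.encard = 5 →
      ¬ IsSimilarTo S squareWithCentre → ¬ IsSimilarTo S regularPentagon →
      HasCollinearTriple S ∧ ¬ Admissible numAnglesWithZero 3 S) := by
  refine ⟨⟨⟨squareWithCentre, admissible_of_similar (Or.inl ⟨DilationEquiv.refl _, by simp⟩)⟩, ?_⟩,
    fun S => ⟨fun h => similar_of_admissible h.1 h.2.ge, admissible_of_similar⟩,
    not_similar_pentagon_square, fun S hS h5 hsq hpent => ?_⟩
  · rintro _ ⟨S, hS, rfl⟩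
    by_contra! h
    exact h.ne' (admissible_of_similar (similar_of_admissible hS h.le)).2
  · have hnot : ¬ Admissible numAnglesWithZero 3 S := fun h =>
      (similar_of_admissible h h5.ge).elim hsq hpent
    exact ⟨by_contra fun h => hnot (admissible_of_not_hasCollinearTriple hS h), hnot⟩
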